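/- Let $\mathcal{O}\subset\mathbb{R}^2$ be a bounded open set with smooth boundary (that is, near each boundary point, in suitable orthonormal coordinates, $\mathcal{O}$ is the region strictly above the graph of a $C^\infty$ function); in particular, $\mathcal{O}$ may be any smooth bounded domain. Let $H^1(\mathcal{O})$ be the space of real functions $v\in L^2(\mathcal{O})$ with weak gradient $\nabla v\in L^2(\mathcal{O};\mathbb{R}^2)$, with norm $\|v\|_{H^1(\mathcal{O})}=\big(\|v\|_{L^2(\mathcal{O})}^2+\|\nabla v\|_{L^2(\mathcal{O})}^2\big)^{1/2}$, and let $H^1(\mathcal{O})'$ be its dual with the dual norm; each $\xi\in L^2(\mathcal{O})$ is identified with the functional $v\mapsto\int_{\mathcal{O}}\xi v\,dx$ in $H^1(\mathcal{O})'$. Then there exists a constant $c>0$, depending only on $\mathcal{O}$, such that $$\|\xi\|_{H^1(\mathcal{O})'}\le c\Big(1+\|\xi\|_{L^1(\mathcal{O})}\,\log^{1/2}\big(e+\|\xi\|_{L^2(\mathcal{O})}\big)\Big)\qquad\text{for all }\xi\in L^2(\mathcal{O}).$$ -/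

import Mathlib

open MeasureTheory

noncomputable section

/-- The Euclidean plane `ℝ²`. -/
abbrev Plane : Type := EuclideanSpace ℝ (Fin 2)

/-- A bounded open subset of the plane with smooth boundary: around each boundary point `x₀`, in
suitable orthonormal coordinates `y = e x`, the set is the part of a small ball that lies strictly
above the graph `y₁ = γ y₀` of a `C^∞` function `γ`. Connectedness is not required. -/
structure IsSmoothBoundedOpen (O : Set Plane) : Prop where
  isOpen : IsOpen O
  isBounded : Bornology.IsBounded O
  smooth_boundary : ∀ x₀ ∈ frontier O, ∃ (e : Plane ≃ₗᵢ[ℝ] Plane) (γ : ℝ → ℝ) (r : ℝ),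
    ContDiff ℝ ((⊤ : ℕ∞) : WithTop ℕ∞) γ ∧ 0 < r ∧
      ∀ x ∈ Metric.ball x₀ r, x ∈ O ↔ γ (e x 0) < e x 1

/-- Test functions: `φ ∈ C_c^∞(O)`, extended by zero to the plane. -/
structure IsTestFunction (O : Set Plane) (φ : Plane → ℝ) : Prop where
  contDiff : ContDiff ℝ ((⊤ : ℕ∞) : WithTop ℕ∞) φ
  hasCompactSupport : HasCompactSupport φ
  tsupport_subset : tsupport φ ⊆ O

/-- The partial derivative `∂ᵢ φ`. -/
def partialDeriv (i : Fin 2) (φ : Plane → ℝ) (x : Plane) : ℝ :=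
  fderiv ℝ φ x (EuclideanSpace.single i 1)

/-- `g` is the weak gradient of `v` on `O`. -/
def IsWeakGradient (O : Set Plane) (v : Plane → ℝ) (g : Plane → Plane) : Prop :=
  ∀ φ : Plane → ℝ, IsTestFunction O φ → ∀ i : Fin 2,
    ∫ x in O, v x * partialDeriv i φ x = - ∫ x in O, g x i * φ x

/-- The real space `L²(O)`. -/
abbrev L2 (O : Set Plane) : Type := Lp ℝ 2 (volume.restrict O)

/-- The space `L²(O; ℝ²)`. -/
abbrev L2Vec (O : Set Plane) : Type := Lp Plane 2 (volume.restrict O)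

lemma IsTestFunction.memLp {O : Set Plane} {φ : Plane → ℝ} (h : IsTestFunction O φ) :
    MemLp φ 2 (volume.restrict O) :=
  (h.contDiff.continuous.memLp_of_hasCompactSupport h.hasCompactSupport).restrict O

lemma IsTestFunction.memLp_partialDeriv {O : Set Plane} {φ : Plane → ℝ}
    (h : IsTestFunction O φ) (i : Fin 2) :
    MemLp (partialDeriv i φ) 2 (volume.restrict O) := by
  have hc : Continuous (partialDeriv i φ) :=
    (h.contDiff.continuous_fderiv (by simp)).clm_apply continuous_const
  have hs : HasCompactSupport (partialDeriv i φ) :=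
    h.hasCompactSupport.fderiv_apply (𝕜 := ℝ) (EuclideanSpace.single i 1)
  exact (hc.memLp_of_hasCompactSupport hs).restrict O

lemma L2Vec.memLp_coord {O : Set Plane} (g : L2Vec O) (i : Fin 2) :
    MemLp (fun x => g x i) 2 (volume.restrict O) :=
  (Lp.memLp g).continuousLinearMap_comp (EuclideanSpace.proj (𝕜 := ℝ) i)

/-- The Sobolev space `H¹(O)`, realised as the set of pairs `(v, ∇v)` with `v ∈ L²(O)` and weak
gradient `∇v ∈ L²(O; ℝ²)`. Its norm, inherited from the `ℓ²`-product, is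
`(‖v‖² + ‖∇v‖²)^(1/2)`. -/
def H1 (O : Set Plane) : Submodule ℝ (WithLp 2 (L2 O × L2Vec O)) where
  carrier := {p | IsWeakGradient O p.fst p.snd}
  zero_mem' := by
    intro φ hφ i
    have h1 : ∫ x in O, (0 : L2 O) x * partialDeriv i φ x = 0 := by
      refine integral_eq_zero_of_ae ?_
      filter_upwards [Lp.coeFn_zero ℝ 2 (volume.restrict O)] with x hx
      rw [hx]
      simp
    have h2 : ∫ x in O, (0 : L2Vec O) x i * φ x = 0 := by
      refine integral_eq_zero_of_ae ?_
      filter_upwards [Lp.coeFn_zero Plane 2 (volume.restrict O)] with x hx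
      rw [hx]
      simp
    rw [WithLp.zero_fst, WithLp.zero_snd, h1, h2, neg_zero]
  add_mem' := by
    intro p q hp hq φ hφ i
    have e1 : ∫ x in O, (p.fst + q.fst) x * partialDeriv i φ x
        = ∫ x in O, (p.fst x * partialDeriv i φ x + q.fst x * partialDeriv i φ x) := by
      refine integral_congr_ae ?_
      filter_upwards [Lp.coeFn_add p.fst q.fst] with x hx
      rw [hx]
      simp [add_mul]
    have e2 : ∫ x in O, (p.snd + q.snd) x i * φ x
        = ∫ x in O, (p.snd x i * φ x + q.snd x i * φ x) := by
      refine integral_congr_ae ?_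
      filter_upwards [Lp.coeFn_add p.snd q.snd] with x hx
      rw [hx]
      simp [add_mul]
    have i1 : ∀ u : L2 O, Integrable (fun x => u x * partialDeriv i φ x) (volume.restrict O) :=
      fun u => (Lp.memLp u).integrable_mul (hφ.memLp_partialDeriv i)
    have i2 : ∀ g : L2Vec O, Integrable (fun x => g x i * φ x) (volume.restrict O) :=
      fun g => (L2Vec.memLp_coord g i).integrable_mul hφ.memLp
    rw [WithLp.add_fst, WithLp.add_snd, e1, e2, integral_add (i1 _) (i1 _),
      integral_add (i2 _) (i2 _), hp φ hφ i, hq φ hφ i]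
    ring
  smul_mem' := by
    intro a p hp φ hφ i
    have e1 : ∫ x in O, (a • p.fst) x * partialDeriv i φ x
        = a * ∫ x in O, p.fst x * partialDeriv i φ x := by
      rw [← integral_const_mul]
      refine integral_congr_ae ?_
      filter_upwards [Lp.coeFn_smul a p.fst] with x hx
      rw [hx]
      simp [mul_assoc]
    have e2 : ∫ x in O, (a • p.snd) x i * φ x = a * ∫ x in O, p.snd x i * φ x := by
      rw [← integral_const_mul]
      refine integral_congr_ae ?_
      filter_upwards [Lp.coeFn_smul a p.snd] with x hx
      rw [hx]
      simp [mul_assoc]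
    rw [WithLp.smul_fst, WithLp.smul_snd, e1, e2, hp φ hφ i]
    ring

/-- The continuous inclusion `H¹(O) → L²(O)`, `v ↦ v`. -/
def H1.toL2 (O : Set Plane) : H1 O →L[ℝ] L2 O :=
  (ContinuousLinearMap.fst ℝ (L2 O) (L2Vec O)).comp
    ((WithLp.prodContinuousLinearEquiv 2 ℝ (L2 O) (L2Vec O)).toContinuousLinearMap.comp
      (H1 O).subtypeL)

/-- The element `v ↦ (ξ, v)_{L²(O)}` of the dual `H¹(O)'` given by `ξ ∈ L²(O)`. -/
def L2.toH1Dual {O : Set Plane} (ξ : L2 O) : StrongDual ℝ (H1 O) :=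
  (innerSL ℝ ξ).comp (H1.toL2 O)

end

/-!
A smooth domain contains, with each of its points `x` near a given point of its closure, a cone
`{x + t • y | t ∈ (0, 1], y ∈ B}`, where `B` is a ball of directions away from `0`. Averaging
`v x = v (x + y) - ∫₀¹ ∇v (x + t • y) · y dt` over `y ∈ B` bounds `|v x|` by `‖v‖_{L²}` plus the
integral of `|∇v|` over this cone in the coordinates `(t, y)`, which is cut at `t = δ`.

* For `t > δ`, Cauchy–Schwarz gives the pointwise bound `log^{1/2} δ⁻¹ ‖∇v‖_{L²}`: on the one hand
  `∫_δ^1 dt / t = log δ⁻¹`, on the other hand `(t, y) ↦ t • y` maps `t dt dy` to a measure of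
  bounded density, because the dimension is the exponent `2`.
* For `t ≤ δ`, translation invariance bounds the `L²` norm in `x` by a multiple of `δ ‖∇v‖_{L²}`.

Pairing the first part with `ξ ∈ L¹` and the second with `ξ ∈ L²`, and using compactness of the
closure, bounds the dual norm of `ξ` by a multiple of
`‖ξ‖_{L¹} (1 + log^{1/2} δ⁻¹) + δ ‖ξ‖_{L²}`; then `δ = (e + ‖ξ‖_{L²})⁻¹`.
-/

open Module (finrank)
open Metric (ball)
open Set (Ioc Icc Ioi)
open scoped ENNReal NNReal ContDiff

section ConeIntegral

lemma setLIntegral_Ioc_ofReal_inv {a b : ℝ} (ha : 0 < a) (hab : a ≤ b) :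
    ∫⁻ t in Ioc a b, ENNReal.ofReal t⁻¹ = ENNReal.ofReal (Real.log (b / a)) := by
  have hint : IntegrableOn (fun t : ℝ => t⁻¹) (Ioc a b) := by
    rw [← intervalIntegrable_iff_integrableOn_Ioc_of_le hab]
    refine intervalIntegral.intervalIntegrable_inv (fun t ht => ?_) continuousOn_id
    rw [Set.uIcc_of_le hab] at ht
    exact (ha.trans_le ht.1).ne'
  have hnonneg : 0 ≤ᵐ[volume.restrict (Ioc a b)] fun t => t⁻¹ := by
    filter_upwards [ae_restrict_mem measurableSet_Ioc] with t ht
    exact inv_nonneg.2 (ha.trans ht.1).le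
  rw [← ofReal_integral_eq_lintegral_ofReal hint hnonneg, ← intervalIntegral.integral_of_le hab,
    integral_inv_of_pos ha (ha.trans_le hab)]

lemma setLIntegral_Ioc_prod_ofReal_inv {α : Type*} [MeasurableSpace α] {μ : Measure α}
    [SFinite μ] {a b : ℝ} (ha : 0 < a) (hab : a ≤ b) (B : Set α) :
    ∫⁻ z in Ioc a b ×ˢ B, ENNReal.ofReal z.1⁻¹ ∂volume.prod μ
      = ENNReal.ofReal (Real.log (b / a)) * μ B := by
  rw [← Measure.prod_restrict, lintegral_prod _ (by fun_prop)]
  simp only [lintegral_const, Measure.restrict_apply_univ]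
  rw [lintegral_mul_const _ (by fun_prop), setLIntegral_Ioc_ofReal_inv ha hab]

variable {E : Type*} [NormedAddCommGroup E] [NormedSpace ℝ E]

/-- The integral of `G` over the cone with vertex `x` spanned by `B`, written in the parameters
`(t, y) ∈ s × B` of the point `x + t • y`, so that the Jacobian `t ^ (dim E)` is not included. -/
noncomputable def coneLIntegral [MeasurableSpace E] (μ : Measure E) (B : Set E) (s : Set ℝ)
    (G : E → ℝ≥0∞) (x : E) : ℝ≥0∞ :=
  ∫⁻ z in s ×ˢ B, G (x + z.1 • z.2) ∂volume.prod μ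

lemma mem_Ioc_of_inv_smul_mem_ball {p w : E} {b t : ℝ} (hbp : b < ‖p‖) (ht : 0 < t)
    (hw : t⁻¹ • w ∈ ball p b) : t ∈ Ioc (‖w‖ / (‖p‖ + b)) (‖w‖ / (‖p‖ - b)) := by
  have hb : 0 < b := Metric.pos_of_mem_ball hw
  have hdist : |‖w‖ / t - ‖p‖| < b := by
    have hnorm : ‖t⁻¹ • w‖ = ‖w‖ / t := by
      rw [norm_smul, norm_inv, Real.norm_of_nonneg ht.le, inv_mul_eq_div]
    rw [← hnorm]
    exact (abs_norm_sub_norm_le _ _).trans_lt (mem_ball_iff_norm.1 hw)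
  obtain ⟨hlower, hupper⟩ := abs_lt.1 hdist
  have hlower' : (‖p‖ - b) * t < ‖w‖ := by rw [← lt_div_iff₀ ht]; linarith
  have hupper' : ‖w‖ < (‖p‖ + b) * t := by rw [← div_lt_iff₀ ht]; linarith
  constructor
  · rwa [div_lt_iff₀' (by linarith)]
  · rw [le_div_iff₀' (by linarith)]
    exact hlower'.le

lemma setLIntegral_inv_mul_indicator_ball_le {p : E} {b : ℝ} (hb : 0 < b) (hbp : b < ‖p‖) (w : E) :
    ∫⁻ t in Ioi (0 : ℝ), ENNReal.ofReal t⁻¹ * (ball p b).indicator 1 (t⁻¹ • w)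
      ≤ ENNReal.ofReal (Real.log ((‖p‖ + b) / (‖p‖ - b))) := by
  rcases eq_or_ne w 0 with rfl | hw
  · have h0 : (0 : E) ∉ ball p b := by simpa using hbp.le
    simp [h0]
  have : 0 < ‖w‖ := norm_pos_iff.2 hw
  have : 0 < ‖p‖ + b := by positivity
  have : 0 < ‖p‖ - b := sub_pos.2 hbp
  set S := Ioc (‖w‖ / (‖p‖ + b)) (‖w‖ / (‖p‖ - b))
  calc ∫⁻ t in Ioi (0 : ℝ), ENNReal.ofReal t⁻¹ * (ball p b).indicator 1 (t⁻¹ • w)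
      ≤ ∫⁻ t in Ioi (0 : ℝ), S.indicator (fun t => ENNReal.ofReal t⁻¹) t := by
        refine setLIntegral_mono' measurableSet_Ioi fun t ht => ?_
        by_cases htw : t⁻¹ • w ∈ ball p b
        · simp [htw, S, mem_Ioc_of_inv_smul_mem_ball hbp ht htw]
        · simp [htw]
    _ ≤ ∫⁻ t, S.indicator (fun t => ENNReal.ofReal t⁻¹) t := setLIntegral_le_lintegral _ _
    _ = ENNReal.ofReal (Real.log ((‖w‖ / (‖p‖ - b)) / (‖w‖ / (‖p‖ + b)))) := by
        rw [lintegral_indicator measurableSet_Ioc]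
        exact setLIntegral_Ioc_ofReal_inv (by positivity) (by gcongr; linarith)
    _ = ENNReal.ofReal (Real.log ((‖p‖ + b) / (‖p‖ - b))) := by
        congr 2
        field_simp

variable [MeasurableSpace E] {μ : Measure E}

lemma coneLIntegral_Ioc_add (B : Set E) (hB : MeasurableSet B) {a b c : ℝ} (hab : a ≤ b)
    (hbc : b ≤ c) (G : E → ℝ≥0∞) (x : E) :
    coneLIntegral μ B (Ioc a c) G x
      = coneLIntegral μ B (Ioc a b) G x + coneLIntegral μ B (Ioc b c) G x := by
  rw [coneLIntegral, coneLIntegral, coneLIntegral, ← lintegral_union (measurableSet_Ioc.prod hB),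
    ← Set.union_prod, Set.Ioc_union_Ioc_eq_Ioc hab hbc]
  exact Set.disjoint_prod.2 (Or.inl (Set.Ioc_disjoint_Ioc_of_le le_rfl))

variable [BorelSpace E] [FiniteDimensional ℝ E]

lemma lintegral_mul_coneLIntegral_le [SFinite μ] [μ.IsAddRightInvariant] {p q : ℝ}
    (hpq : p.HolderConjugate q) (B : Set E) (s : Set ℝ) {X G : E → ℝ≥0∞} (hX : Measurable X)
    (hG : Measurable G) :
    ∫⁻ x, X x * coneLIntegral μ B s G x ∂μ
      ≤ volume s * μ B * (eLpNorm' X p μ * eLpNorm' G q μ) := by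
  have hmeas : Measurable fun z : E × ℝ × E => X z.1 * G (z.1 + z.2.1 • z.2.2) :=
    (hX.comp (by fun_prop)).mul (hG.comp (by fun_prop))
  have hholder (a : E) : ∫⁻ x, X x * G (x + a) ∂μ ≤ eLpNorm' X p μ * eLpNorm' G q μ := by
    refine (ENNReal.lintegral_mul_le_Lp_mul_Lq μ hpq hX.aemeasurable
      (hG.comp (measurable_add_const a)).aemeasurable).trans_eq ?_
    simp only [eLpNorm'_eq_lintegral_enorm, enorm_eq_self, Function.comp_apply]
    rw [lintegral_add_right_eq_self (fun x => G x ^ q) a]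
  calc ∫⁻ x, X x * coneLIntegral μ B s G x ∂μ
      = ∫⁻ x, ∫⁻ z in s ×ˢ B, X x * G (x + z.1 • z.2) ∂volume.prod μ ∂μ := by
        refine lintegral_congr fun x => (lintegral_const_mul _ ?_).symm
        exact hG.comp (by fun_prop)
    _ = ∫⁻ z in s ×ˢ B, ∫⁻ x, X x * G (x + z.1 • z.2) ∂μ ∂volume.prod μ :=
        lintegral_lintegral_swap hmeas.aemeasurable
    _ ≤ ∫⁻ _ in s ×ˢ B, eLpNorm' X p μ * eLpNorm' G q μ ∂volume.prod μ :=
        lintegral_mono fun z => hholder (z.1 • z.2)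
    _ = volume s * μ B * (eLpNorm' X p μ * eLpNorm' G q μ) := by
        rw [setLIntegral_const, Measure.prod_prod, mul_comm]

lemma coneLIntegral_le_rpow_mul_rpow [SFinite μ] {p q : ℝ} (hpq : p.HolderConjugate q) {B : Set E}
    (hB : MeasurableSet B) {s : Set ℝ} (hs : MeasurableSet s) (hs0 : s ⊆ Ioi 0) {G : E → ℝ≥0∞}
    (hG : Measurable G) (x : E) :
    coneLIntegral μ B s G x
      ≤ (∫⁻ z in s ×ˢ B, ENNReal.ofReal z.1 ^ (p - 1) * G (x + z.1 • z.2) ^ p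
            ∂volume.prod μ) ^ (1 / p)
        * (∫⁻ z in s ×ˢ B, ENNReal.ofReal z.1⁻¹ ∂volume.prod μ) ^ (1 / q) := by
  have : Measurable fun z : ℝ × E => G (x + z.1 • z.2) := hG.comp (by fun_prop)
  have hweight {t : ℝ} (ht : 0 < t) (c : ℝ≥0∞) :
      ENNReal.ofReal t ^ (1 / q) * c * ENNReal.ofReal t⁻¹ ^ (1 / q) = c := by
    rw [mul_right_comm, ← ENNReal.mul_rpow_of_nonneg _ _ hpq.symm.one_div_nonneg,
      ← ENNReal.ofReal_mul ht.le, mul_inv_cancel₀ ht.ne', ENNReal.ofReal_one, ENNReal.one_rpow,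
      one_mul]
  have hpow (a c : ℝ≥0∞) : (a ^ (1 / q) * c) ^ p = a ^ (p - 1) * c ^ p := by
    rw [ENNReal.mul_rpow_of_nonneg _ _ hpq.nonneg, ← ENNReal.rpow_mul, one_div_mul_eq_div,
      hpq.div_conj_eq_sub_one]
  have hinv (a : ℝ≥0∞) : (a ^ (1 / q)) ^ q = a := by
    rw [← ENNReal.rpow_mul, one_div_mul_cancel hpq.symm.ne_zero, ENNReal.rpow_one]
  calc coneLIntegral μ B s G x
      = ∫⁻ z in s ×ˢ B, ENNReal.ofReal z.1 ^ (1 / q) * G (x + z.1 • z.2)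
          * ENNReal.ofReal z.1⁻¹ ^ (1 / q) ∂volume.prod μ :=
        setLIntegral_congr_fun (hs.prod hB) fun z hz => (hweight (hs0 hz.1) _).symm
    _ ≤ (∫⁻ z in s ×ˢ B, (ENNReal.ofReal z.1 ^ (1 / q) * G (x + z.1 • z.2)) ^ p
            ∂volume.prod μ) ^ (1 / p)
          * (∫⁻ z in s ×ˢ B, (ENNReal.ofReal z.1⁻¹ ^ (1 / q)) ^ q ∂volume.prod μ) ^ (1 / q) :=
        ENNReal.lintegral_mul_le_Lp_mul_Lq _ hpq (by fun_prop) (by fun_prop)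
    _ = _ := by simp only [hpow, hinv]

variable [μ.IsAddHaarMeasure]

lemma setLIntegral_comp_add_smul {B : Set E} (hB : MeasurableSet B) {H : E → ℝ≥0∞}
    (hH : Measurable H) (x : E) {t : ℝ} (ht : 0 < t) :
    ∫⁻ y in B, H (x + t • y) ∂μ
      = ENNReal.ofReal (t ^ finrank ℝ E)⁻¹ * ∫⁻ w, H (x + w) * B.indicator 1 (t⁻¹ • w) ∂μ := by
  have hmeas : Measurable fun w => H (x + w) * B.indicator 1 (t⁻¹ • w) :=
    (hH.comp (measurable_const_add x)).mul
      ((measurable_one.indicator hB).comp (measurable_const_smul _))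
  have hmap := lintegral_map (μ := μ) hmeas (measurable_const_smul t)
  rw [Measure.map_addHaar_smul μ ht.ne', lintegral_smul_measure, abs_of_pos (by positivity)] at hmap
  rw [← smul_eq_mul, hmap, ← lintegral_indicator hB]
  refine lintegral_congr fun y => ?_
  rw [inv_smul_smul₀ ht.ne']
  by_cases hy : y ∈ B <;> simp [hy]

lemma rpow_mul_setLIntegral_comp_add_smul {B : Set E} (hB : MeasurableSet B) {H : E → ℝ≥0∞}
    (hH : Measurable H) (x : E) {t : ℝ} (ht : 0 < t) :
    ENNReal.ofReal t ^ (finrank ℝ E - 1 : ℝ) * ∫⁻ y in B, H (x + t • y) ∂μ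
      = ∫⁻ w, H (x + w) * (ENNReal.ofReal t⁻¹ * B.indicator 1 (t⁻¹ • w)) ∂μ := by
  have hjac : ENNReal.ofReal t ^ (finrank ℝ E - 1 : ℝ) * ENNReal.ofReal (t ^ finrank ℝ E)⁻¹
      = ENNReal.ofReal t⁻¹ := by
    rw [ENNReal.ofReal_rpow_of_pos ht, ← ENNReal.ofReal_mul (Real.rpow_nonneg ht.le _),
      Real.rpow_sub_one ht.ne', Real.rpow_natCast]
    congr 1
    field_simp
  rw [setLIntegral_comp_add_smul hB hH x ht, ← mul_assoc, hjac,
    ← lintegral_const_mul' _ _ ENNReal.ofReal_ne_top]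
  exact lintegral_congr fun w => by ring

-- The rays meet the ball in segments along which `t` varies by a bounded factor, so the image of
-- `t ^ (dim E - 1) dt dy` under `(t, y) ↦ t • y` has bounded density.
lemma setLIntegral_Ioi_prod_ball_rpow_mul_le {p : E} {b : ℝ} (hb : 0 < b) (hbp : b < ‖p‖)
    {H : E → ℝ≥0∞} (hH : Measurable H) (x : E) :
    ∫⁻ z in Ioi (0 : ℝ) ×ˢ ball p b,
        ENNReal.ofReal z.1 ^ (finrank ℝ E - 1 : ℝ) * H (x + z.1 • z.2) ∂volume.prod μ
      ≤ ENNReal.ofReal (Real.log ((‖p‖ + b) / (‖p‖ - b))) * ∫⁻ w, H w ∂μ := by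
  have hind : Measurable ((ball p b).indicator (1 : E → ℝ≥0∞)) :=
    measurable_one.indicator measurableSet_ball
  have hmeas : Measurable fun z : ℝ × E =>
      H (x + z.2) * (ENNReal.ofReal z.1⁻¹ * (ball p b).indicator 1 (z.1⁻¹ • z.2)) := by
    fun_prop
  calc ∫⁻ z in Ioi (0 : ℝ) ×ˢ ball p b,
        ENNReal.ofReal z.1 ^ (finrank ℝ E - 1 : ℝ) * H (x + z.1 • z.2) ∂volume.prod μ
      = ∫⁻ t in Ioi (0 : ℝ), ENNReal.ofReal t ^ (finrank ℝ E - 1 : ℝ)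
          * ∫⁻ y in ball p b, H (x + t • y) ∂μ := by
        rw [← Measure.prod_restrict, lintegral_prod _ (by fun_prop)]
        exact lintegral_congr fun t => by rw [← lintegral_const_mul _ (by fun_prop)]
    _ = ∫⁻ t in Ioi (0 : ℝ), (∫⁻ w,
          H (x + w) * (ENNReal.ofReal t⁻¹ * (ball p b).indicator 1 (t⁻¹ • w)) ∂μ) :=
        setLIntegral_congr_fun measurableSet_Ioi fun t ht =>
          rpow_mul_setLIntegral_comp_add_smul measurableSet_ball hH x ht
    _ = ∫⁻ w, (∫⁻ t in Ioi (0 : ℝ),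
          H (x + w) * (ENNReal.ofReal t⁻¹ * (ball p b).indicator 1 (t⁻¹ • w))) ∂μ :=
        lintegral_lintegral_swap hmeas.aemeasurable
    _ ≤ ∫⁻ w, H (x + w) * ENNReal.ofReal (Real.log ((‖p‖ + b) / (‖p‖ - b))) ∂μ := by
        refine lintegral_mono fun w => (lintegral_const_mul _ (by fun_prop)).trans_le ?_
        gcongr
        exact setLIntegral_inv_mul_indicator_ball_le hb hbp w
    _ = ENNReal.ofReal (Real.log ((‖p‖ + b) / (‖p‖ - b))) * ∫⁻ w, H w ∂μ := by
        rw [lintegral_add_left_eq_self (fun w => H w * _) x, lintegral_mul_const _ hH, mul_comm]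

lemma coneLIntegral_Ioc_one_le {q : ℝ} (hq : (finrank ℝ E : ℝ).HolderConjugate q) {p : E} {b : ℝ}
    (hb : 0 < b) (hbp : b < ‖p‖) {δ : ℝ} (hδ : 0 < δ) (hδ1 : δ ≤ 1) {G : E → ℝ≥0∞}
    (hG : Measurable G) (x : E) :
    coneLIntegral μ (ball p b) (Ioc δ 1) G x
      ≤ ENNReal.ofReal (Real.log ((‖p‖ + b) / (‖p‖ - b))) ^ (1 / finrank ℝ E : ℝ)
        * eLpNorm' G (finrank ℝ E) μ
        * (ENNReal.ofReal (Real.log δ⁻¹) * μ (ball p b)) ^ (1 / q) := by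
  set d : ℝ := (finrank ℝ E : ℝ)
  set B := ball p b
  have hpos : Ioc δ 1 ⊆ Ioi 0 := fun t ht => hδ.trans ht.1
  have hmass : ∫⁻ z in Ioc δ 1 ×ˢ B, ENNReal.ofReal z.1⁻¹ ∂volume.prod μ
      = ENNReal.ofReal (Real.log δ⁻¹) * μ B := by
    rw [setLIntegral_Ioc_prod_ofReal_inv hδ hδ1, one_div]
  have hjacobian : ∫⁻ z in Ioc δ 1 ×ˢ B, ENNReal.ofReal z.1 ^ (d - 1) * G (x + z.1 • z.2) ^ d
        ∂volume.prod μ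
      ≤ ENNReal.ofReal (Real.log ((‖p‖ + b) / (‖p‖ - b))) * ∫⁻ z, G z ^ d ∂μ :=
    (lintegral_mono_set (Set.prod_mono_left hpos)).trans
      (setLIntegral_Ioi_prod_ball_rpow_mul_le hb hbp (hG.pow_const d) x)
  refine (coneLIntegral_le_rpow_mul_rpow hq measurableSet_ball measurableSet_Ioc hpos hG x).trans ?_
  rw [hmass, eLpNorm'_eq_lintegral_enorm, ← ENNReal.mul_rpow_of_nonneg _ _ hq.one_div_nonneg]
  simp only [enorm_eq_self]
  gcongr

end ConeIntegral

section Segments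

variable {E : Type*} [NormedAddCommGroup E] [NormedSpace ℝ E]

lemma apply_sub_sub_apply_eq_neg_setIntegral_fderiv {φ : E → ℝ} (hφ : ContDiff ℝ 1 φ) (x y : E) :
    φ (x - y) - φ x = -∫ t in Ioc (0 : ℝ) 1, fderiv ℝ φ (x - t • y) y := by
  have hderiv (t : ℝ) :
      HasDerivAt (fun t : ℝ => φ (x - t • y)) (-(fderiv ℝ φ (x - t • y) y)) t := by
    have hsegment : HasDerivAt (fun t : ℝ => x - t • y) (-y) t := by
      simpa using ((hasDerivAt_id t).smul_const y).const_sub x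
    have hcomp := (hφ.differentiable one_ne_zero (x - t • y)).hasFDerivAt.comp_hasDerivAt t hsegment
    rwa [map_neg] at hcomp
  have hcont : Continuous fun t : ℝ => -(fderiv ℝ φ (x - t • y) y) :=
    (((hφ.continuous_fderiv one_ne_zero).comp (by fun_prop)).clm_apply continuous_const).neg
  have hftc := intervalIntegral.integral_eq_sub_of_hasDerivAt (a := 0) (b := 1)
    (fun t _ => hderiv t) (hcont.intervalIntegrable _ _)
  rw [intervalIntegral.integral_of_le zero_le_one, integral_neg] at hftc
  simpa using hftc.symm

variable [MeasurableSpace E] {μ : Measure E}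

/-- `G` is the weak derivative of `V` in the direction `y` on `O`. -/
def IsWeakDirDeriv (μ : Measure E) (O : Set E) (y : E) (V G : E → ℝ) : Prop :=
  ∀ φ : E → ℝ, ContDiff ℝ ∞ φ → HasCompactSupport φ → tsupport φ ⊆ O →
    ∫ x, fderiv ℝ φ x y * V x ∂μ = -∫ x, φ x * G x ∂μ

variable [BorelSpace E] [μ.IsAddHaarMeasure]

lemma IsWeakDirDeriv.integral_fderiv_sub_mul {O : Set E} {V G φ : E → ℝ} {y : E}
    (h : IsWeakDirDeriv μ O y V G) (hφ : ContDiff ℝ ∞ φ) (hφc : HasCompactSupport φ)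
    (a : E) (ha : ∀ x ∈ tsupport φ, x + a ∈ O) :
    ∫ x, fderiv ℝ φ (x - a) y * V x ∂μ = -∫ x, φ x * G (x + a) ∂μ := by
  have hsupp : tsupport (fun x => φ (x - a)) ⊆ O := fun x hx => by
    simpa using ha _ (tsupport_comp_subset_preimage φ (continuous_sub_right a) hx)
  have hweak := h (fun x => φ (x - a)) (hφ.comp (contDiff_id.sub contDiff_const))
    (hφc.comp_homeomorph (Homeomorph.subRight a)) hsupp
  simp only [fderiv_comp_sub] at hweak
  rw [hweak, ← integral_add_right_eq_self (fun x => φ (x - a) * G x) a]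
  simp only [add_sub_cancel_right]

variable [FiniteDimensional ℝ E]

lemma integrable_comp_add_smul {F : E → ℝ} (hF : Integrable F μ) (ν : Measure ℝ)
    [IsFiniteMeasure ν] (y : E) :
    Integrable (fun z : E × ℝ => F (z.1 + z.2 • y)) (μ.prod ν) := by
  have hqmp : Measure.QuasiMeasurePreserving (fun z : E × ℝ => z.1 + z.2 • y) (μ.prod ν) μ :=
    QuasiMeasurePreserving.prod_of_left (by fun_prop)
      (ae_of_all _ fun t => (measurePreserving_add_right μ (t • y)).quasiMeasurePreserving)
  have hmeas : AEStronglyMeasurable (fun z : E × ℝ => F (z.1 + z.2 • y)) (μ.prod ν) :=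
    hF.aestronglyMeasurable.comp_quasiMeasurePreserving hqmp
  rw [integrable_prod_iff' hmeas]
  refine ⟨ae_of_all _ fun t => hF.comp_add_right (t • y), ?_⟩
  simp only [fun t : ℝ => integral_add_right_eq_self (μ := μ) (fun x => ‖F x‖) (t • y)]
  exact integrable_const _

lemma integral_apply_sub_sub_apply_mul {φ V : E → ℝ} (hφ : ContDiff ℝ 1 φ)
    (hφc : HasCompactSupport φ) (hV : Integrable V μ) (y : E) :
    ∫ x, (φ (x - y) - φ x) * V x ∂μ
      = -∫ t in Ioc (0 : ℝ) 1, ∫ x, fderiv ℝ φ (x - t • y) y * V x ∂μ := by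
  have hcont : Continuous fun x => fderiv ℝ φ x y :=
    (hφ.continuous_fderiv one_ne_zero).clm_apply continuous_const
  obtain ⟨C, hC⟩ := (hφc.fderiv_apply (𝕜 := ℝ) y).exists_bound_of_continuous hcont
  have hint : Integrable (fun z : E × ℝ => fderiv ℝ φ (z.1 - z.2 • y) y * V z.1)
      (μ.prod (volume.restrict (Ioc (0 : ℝ) 1))) :=
    (hV.comp_fst _).bdd_mul (c := C)
      (hcont.comp (g := fun x => fderiv ℝ φ x y) (by fun_prop)).aestronglyMeasurable
      (ae_of_all _ fun z => hC _)
  calc ∫ x, (φ (x - y) - φ x) * V x ∂μ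
      = -∫ x, (∫ t in Ioc (0 : ℝ) 1, fderiv ℝ φ (x - t • y) y * V x) ∂μ := by
        simp only [apply_sub_sub_apply_eq_neg_setIntegral_fderiv hφ, neg_mul, integral_neg,
          integral_mul_const]
    _ = -∫ t in Ioc (0 : ℝ) 1, ∫ x, fderiv ℝ φ (x - t • y) y * V x ∂μ := by
        rw [integral_integral_swap hint]

namespace IsWeakDirDeriv

variable {O U : Set E} {V G φ : E → ℝ} {y : E}

lemma integral_apply_sub_sub_apply_mul_eq (h : IsWeakDirDeriv μ O y V G) (hV : Integrable V μ)
    (hG : Integrable G μ) (hφ : ContDiff ℝ ∞ φ) (hφc : HasCompactSupport φ)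
    (hy : ∀ x ∈ tsupport φ, ∀ t ∈ Icc (0 : ℝ) 1, x + t • y ∈ O) :
    ∫ x, (φ (x - y) - φ x) * V x ∂μ
      = ∫ x, φ x * (∫ t in Ioc (0 : ℝ) 1, G (x + t • y)) ∂μ := by
  obtain ⟨C, hC⟩ := hφc.exists_bound_of_continuous hφ.continuous
  have hint : Integrable (fun z : E × ℝ => φ z.1 * G (z.1 + z.2 • y))
      (μ.prod (volume.restrict (Ioc (0 : ℝ) 1))) :=
    (integrable_comp_add_smul hG _ y).bdd_mul (c := C)
      (hφ.continuous.comp continuous_fst).aestronglyMeasurable (ae_of_all _ fun z => hC _)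
  have hweak : ∀ t ∈ Ioc (0 : ℝ) 1,
      ∫ x, fderiv ℝ φ (x - t • y) y * V x ∂μ = -∫ x, φ x * G (x + t • y) ∂μ := fun t ht =>
    h.integral_fderiv_sub_mul hφ hφc _ fun x hx => hy x hx t (Set.Ioc_subset_Icc_self ht)
  rw [integral_apply_sub_sub_apply_mul (hφ.of_le (by simp)) hφc hV,
    setIntegral_congr_fun measurableSet_Ioc hweak, integral_neg, neg_neg,
    ← integral_integral_swap hint]
  simp only [integral_const_mul]

lemma ae_add_sub_eq (h : IsWeakDirDeriv μ O y V G) (hV : Integrable V μ) (hG : Integrable G μ)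
    (hU : IsOpen U) (hy : ∀ x ∈ U, ∀ t ∈ Icc (0 : ℝ) 1, x + t • y ∈ O) :
    ∀ᵐ x ∂μ, x ∈ U → V (x + y) - V x = ∫ t in Ioc (0 : ℝ) 1, G (x + t • y) := by
  have hVy : Integrable (fun x => V (x + y)) μ := hV.comp_add_right y
  have hI : Integrable (fun x => ∫ t in Ioc (0 : ℝ) 1, G (x + t • y)) μ :=
    (integrable_comp_add_smul hG _ y).integral_prod_left
  suffices hzero : ∀ᵐ x ∂μ, x ∈ U →
      (V (x + y) - V x) - ∫ t in Ioc (0 : ℝ) 1, G (x + t • y) = 0 by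
    filter_upwards [hzero] with x hx hxU using sub_eq_zero.1 (hx hxU)
  refine hU.ae_eq_zero_of_integral_contDiff_smul_eq_zero
    (((hVy.sub hV).sub hI).locallyIntegrable.locallyIntegrableOn _) fun φ hφ hφc hφU => ?_
  obtain ⟨C, hC⟩ := hφc.exists_bound_of_continuous hφ.continuous
  have hmul {F : E → ℝ} (hF : Integrable F μ) (a : E) : Integrable (fun x => φ (x - a) * F x) μ :=
    hF.bdd_mul (c := C) (hφ.continuous.comp (continuous_sub_right a)).aestronglyMeasurable
      (ae_of_all _ fun x => hC _)
  have hmul₀ {F : E → ℝ} (hF : Integrable F μ) : Integrable (fun x => φ x * F x) μ := by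
    simpa using hmul hF 0
  have htranslate : ∫ x, φ x * V (x + y) ∂μ = ∫ x, φ (x - y) * V x ∂μ := by
    rw [← integral_add_right_eq_self (fun x => φ (x - y) * V x) y]
    simp only [add_sub_cancel_right]
  have hdiff := h.integral_apply_sub_sub_apply_mul_eq hV hG hφ hφc
    fun x hx => hy x (hφU hx)
  simp only [sub_mul] at hdiff
  rw [integral_sub (hmul hV y) (hmul₀ hV)] at hdiff
  simp only [smul_eq_mul, mul_sub]
  rw [integral_sub (by exact (hmul₀ hVy).sub (hmul₀ hV)) (hmul₀ hI),
    integral_sub (hmul₀ hVy) (hmul₀ hV), htranslate, hdiff, sub_self]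

end IsWeakDirDeriv

end Segments

section Averaging

lemma setLIntegral_comp_add_left_le {E : Type*} [AddGroup E] [MeasurableSpace E] [MeasurableAdd E]
    {μ : Measure E} [μ.IsAddLeftInvariant] {p q : ℝ} (hpq : p.HolderConjugate q) {V : E → ℝ≥0∞}
    (hV : Measurable V) (B : Set E) (x : E) :
    ∫⁻ y in B, V (x + y) ∂μ ≤ eLpNorm' V p μ * μ B ^ (1 / q) := by
  calc ∫⁻ y in B, V (x + y) ∂μ
      ≤ (∫⁻ y in B, V (x + y) ^ p ∂μ) ^ (1 / p) * (∫⁻ _ in B, 1 ^ q ∂μ) ^ (1 / q) := by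
        simpa using ENNReal.lintegral_mul_le_Lp_mul_Lq (μ.restrict B) hpq
          (f := fun y => V (x + y)) (g := 1) (by fun_prop) aemeasurable_const
    _ ≤ (∫⁻ y, V (x + y) ^ p ∂μ) ^ (1 / p) * μ B ^ (1 / q) := by
        simp only [ENNReal.one_rpow, setLIntegral_const, one_mul]
        gcongr
        exacts [hpq.one_div_nonneg, Measure.restrict_le_self]
    _ = eLpNorm' V p μ * μ B ^ (1 / q) := by
        rw [lintegral_add_left_eq_self (fun y => V y ^ p) x, eLpNorm'_eq_lintegral_enorm]
        simp only [enorm_eq_self]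

variable {E : Type*} [NormedAddCommGroup E] [NormedSpace ℝ E] [MeasurableSpace E] [BorelSpace E]
  [FiniteDimensional ℝ E] {μ : Measure E} [μ.IsAddHaarMeasure] {B U : Set E} {V G : E → ℝ≥0∞}

lemma ae_measure_mul_le_setLIntegral_add_coneLIntegral {M : ℝ≥0∞} (hB : MeasurableSet B)
    (hU : MeasurableSet U) (hV : Measurable V) (hG : Measurable G)
    (hline : ∀ y ∈ B, ∀ᵐ x ∂μ, x ∈ U →
      V x ≤ V (x + y) + M * ∫⁻ t in Ioc (0 : ℝ) 1, G (x + t • y)) :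
    ∀ᵐ x ∂μ, x ∈ U →
      μ B * V x ≤ (∫⁻ y in B, V (x + y) ∂μ) + M * coneLIntegral μ B (Ioc 0 1) G x := by
  have hVadd : Measurable fun z : E × E => V (z.1 + z.2) := by fun_prop
  have hGadd : Measurable fun z : (E × E) × ℝ => G (z.1.1 + z.2 • z.1.2) := by fun_prop
  have hray : Measurable fun z : E × E => ∫⁻ t in Ioc (0 : ℝ) 1, G (z.1 + t • z.2) :=
    hGadd.lintegral_prod_right'
  have hset : MeasurableSet {z : E × E | z.2 ∈ U →
      V z.2 ≤ V (z.2 + z.1) + M * ∫⁻ t in Ioc (0 : ℝ) 1, G (z.2 + t • z.1)} := by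
    refine (hU.preimage measurable_snd).imp (measurableSet_le (hV.comp measurable_snd) ?_)
    exact (hVadd.add (hray.const_mul M)).comp measurable_swap
  have hswap := (Measure.ae_ae_comm hset).1 ((ae_restrict_iff' hB).2 (ae_of_all μ hline))
  filter_upwards [hswap] with x hx hxU
  have hray_x : Measurable fun y => ∫⁻ t in Ioc (0 : ℝ) 1, G (x + t • y) :=
    hray.comp measurable_prodMk_left
  have hcone : coneLIntegral μ B (Ioc 0 1) G x
      = ∫⁻ y in B, (∫⁻ t in Ioc (0 : ℝ) 1, G (x + t • y)) ∂μ := by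
    rw [coneLIntegral, ← Measure.prod_restrict, lintegral_prod_symm _ (by fun_prop)]
  calc μ B * V x = ∫⁻ _ in B, V x ∂μ := by rw [setLIntegral_const, mul_comm]
    _ ≤ ∫⁻ y in B, (V (x + y) + M * ∫⁻ t in Ioc (0 : ℝ) 1, G (x + t • y)) ∂μ :=
        lintegral_mono_ae (hx.mono fun y hy => hy hxU)
    _ = (∫⁻ y in B, V (x + y) ∂μ) + M * coneLIntegral μ B (Ioc 0 1) G x := by
        rw [lintegral_add_left (by fun_prop), lintegral_const_mul _ hray_x, hcone]

lemma exists_ae_le_add_coneLIntegral (μ : Measure E) [μ.IsAddHaarMeasure] {q : ℝ}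
    (hq : (finrank ℝ E : ℝ).HolderConjugate q) {p : E} {b : ℝ} (hb : 0 < b) (hbp : b < ‖p‖) :
    ∃ C : ℝ≥0, ∀ (U : Set E) (V G : E → ℝ≥0∞) (δ : ℝ), MeasurableSet U → Measurable V →
      Measurable G → 0 < δ → δ ≤ 1 →
      (∀ y ∈ ball p b, ∀ᵐ x ∂μ, x ∈ U →
        V x ≤ V (x + y) + ‖y‖ₑ * ∫⁻ t in Ioc (0 : ℝ) 1, G (x + t • y)) →
      ∀ᵐ x ∂μ, x ∈ U →
        V x ≤ C * (eLpNorm' V (finrank ℝ E) μ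
          + ENNReal.ofReal (Real.log δ⁻¹) ^ (1 / q) * eLpNorm' G (finrank ℝ E) μ
          + coneLIntegral μ (ball p b) (Ioc 0 δ) G x) := by
  set d : ℝ := (finrank ℝ E : ℝ)
  set β := μ (ball p b)
  have hβ0 : β ≠ 0 := (Metric.measure_ball_pos μ p hb).ne'
  have hβ : β ≠ ⊤ := measure_ball_lt_top.ne
  set M := ENNReal.ofReal (‖p‖ + b)
  set K := ENNReal.ofReal (Real.log ((‖p‖ + b) / (‖p‖ - b))) ^ (1 / d)
  have hK : K ≠ ⊤ := ENNReal.rpow_ne_top_of_nonneg hq.one_div_nonneg ENNReal.ofReal_ne_top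
  have hβq : β ^ (1 / q) ≠ ⊤ := ENNReal.rpow_ne_top_of_nonneg hq.symm.one_div_nonneg hβ
  set D := β ^ (1 / q) + M * (K * β ^ (1 / q)) + M
  lift β⁻¹ * D to ℝ≥0 using
    ENNReal.mul_ne_top (ENNReal.inv_ne_top.2 hβ0) (by finiteness) with C hC
  refine ⟨C, fun U V G δ hU hV hG hδ hδ1 hline => ?_⟩
  have hM {y : E} (hy : y ∈ ball p b) : ‖y‖ₑ ≤ M := by
    rw [← ofReal_norm]
    exact ENNReal.ofReal_le_ofReal (norm_lt_of_mem_ball hy).le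
  filter_upwards [ae_measure_mul_le_setLIntegral_add_coneLIntegral measurableSet_ball hU hV hG
    fun y hy => (hline y hy).mono fun x hx hxU => (hx hxU).trans (by gcongr; exact hM hy)]
    with x hx hxU
  set L := ENNReal.ofReal (Real.log δ⁻¹) ^ (1 / q)
  set N := coneLIntegral μ (ball p b) (Ioc 0 δ) G x
  have hfar : coneLIntegral μ (ball p b) (Ioc δ 1) G x
      ≤ K * eLpNorm' G d μ * (L * β ^ (1 / q)) := by
    rw [← ENNReal.mul_rpow_of_nonneg _ _ hq.symm.one_div_nonneg]
    exact coneLIntegral_Ioc_one_le hq hb hbp hδ hδ1 hG x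
  rw [hC, mul_assoc, ← ENNReal.mul_le_iff_le_inv hβ0 hβ]
  calc β * V x
      ≤ (∫⁻ y in ball p b, V (x + y) ∂μ) + M * coneLIntegral μ (ball p b) (Ioc 0 1) G x := hx hxU
    _ ≤ eLpNorm' V d μ * β ^ (1 / q) + M * (N + K * eLpNorm' G d μ * (L * β ^ (1 / q))) := by
        rw [coneLIntegral_Ioc_add _ measurableSet_ball hδ.le hδ1]
        gcongr
        exact setLIntegral_comp_add_left_le hq hV _ x
    _ = β ^ (1 / q) * eLpNorm' V d μ + M * (K * β ^ (1 / q)) * (L * eLpNorm' G d μ) + M * N := by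
        ring
    _ ≤ D * eLpNorm' V d μ + D * (L * eLpNorm' G d μ) + D * N := by
        gcongr
        · exact le_add_right le_self_add
        · exact le_add_right le_add_self
        · exact le_add_self
    _ = D * (eLpNorm' V d μ + L * eLpNorm' G d μ + N) := by ring

lemma exists_lintegral_mul_le_of_ae_le_along_segments (μ : Measure E) [μ.IsAddHaarMeasure]
    {q : ℝ} (hq : (finrank ℝ E : ℝ).HolderConjugate q) {p : E} {b : ℝ} (hb : 0 < b)
    (hbp : b < ‖p‖) :
    ∃ C : ℝ≥0, ∀ (U : Set E) (X V G : E → ℝ≥0∞) (δ : ℝ), MeasurableSet U → Measurable X →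
      Measurable V → Measurable G → 0 < δ → δ ≤ 1 →
      (∀ y ∈ ball p b, ∀ᵐ x ∂μ, x ∈ U →
        V x ≤ V (x + y) + ‖y‖ₑ * ∫⁻ t in Ioc (0 : ℝ) 1, G (x + t • y)) →
      ∫⁻ x in U, X x * V x ∂μ
        ≤ C * ((∫⁻ x, X x ∂μ) * (eLpNorm' V (finrank ℝ E) μ
            + ENNReal.ofReal (Real.log δ⁻¹) ^ (1 / q) * eLpNorm' G (finrank ℝ E) μ)
          + ENNReal.ofReal δ * (eLpNorm' X q μ * eLpNorm' G (finrank ℝ E) μ)) := by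
  obtain ⟨C, hC⟩ := exists_ae_le_add_coneLIntegral μ hq hb hbp
  lift μ (ball p b) to ℝ≥0 using measure_ball_lt_top.ne with β hβ
  refine ⟨C * (1 + β), fun U X V G δ hU hX hV hG hδ hδ1 hline => ?_⟩
  set d : ℝ := (finrank ℝ E : ℝ)
  set A := eLpNorm' V d μ + ENNReal.ofReal (Real.log δ⁻¹) ^ (1 / q) * eLpNorm' G d μ
  set N := coneLIntegral μ (ball p b) (Ioc 0 δ) G
  set I := ∫⁻ x, X x ∂μ
  set P := ENNReal.ofReal δ * (eLpNorm' X q μ * eLpNorm' G d μ)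
  have hnear : ∫⁻ x, X x * N x ∂μ ≤ β * P := by
    simpa [← hβ, P, mul_assoc, mul_left_comm] using
      lintegral_mul_coneLIntegral_le (μ := μ) hq.symm (ball p b) (Ioc 0 δ) hX hG
  calc ∫⁻ x in U, X x * V x ∂μ
      ≤ ∫⁻ x in U, C * (X x * A + X x * N x) ∂μ := by
        refine setLIntegral_mono_ae' hU ?_
        filter_upwards [hC U V G δ hU hV hG hδ hδ1 hline] with x hx hxU
        exact (mul_le_mul_right (hx hxU) (X x)).trans_eq (by ring)
    _ ≤ ∫⁻ x, C * (X x * A + X x * N x) ∂μ := setLIntegral_le_lintegral _ _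
    _ = C * (I * A + ∫⁻ x, X x * N x ∂μ) := by
        rw [lintegral_const_mul' _ _ ENNReal.coe_ne_top, lintegral_add_left (hX.mul_const _),
          lintegral_mul_const _ hX]
    _ ≤ C * ((I * A + P) + (β * (I * A) + β * P)) := by
        gcongr
        exacts [le_self_add, hnear.trans le_add_self]
    _ = (C * (1 + β) : ℝ≥0) * (I * A + P) := by
        push_cast
        ring

end Averaging

section ConeProperty

/-- The uniform interior cone condition for `O` near `x₀`: a fixed truncated cone, translated to
any vertex `x ∈ O` close to `x₀`, stays in `O`. The cone is spanned by the ball `ball p b` of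
directions, from which `b < ‖p‖` excludes `0`. -/
def HasConeAt {E : Type*} [NormedAddCommGroup E] [NormedSpace ℝ E] (O : Set E) (x₀ : E) : Prop :=
  ∃ (ρ : ℝ) (p : E) (b : ℝ), 0 < ρ ∧ 0 < b ∧ b < ‖p‖ ∧
    ∀ x ∈ O ∩ ball x₀ ρ, ∀ y ∈ ball p b, ∀ t ∈ Icc (0 : ℝ) 1, x + t • y ∈ O

lemma add_smul_mem_ball {E : Type*} [NormedAddCommGroup E] [NormedSpace ℝ E] {x₀ p x y : E}
    {ρ b t : ℝ} (hpb : ‖p‖ + b ≤ ρ) (hx : x ∈ ball x₀ ρ) (hy : y ∈ ball p b)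
    (ht : t ∈ Icc (0 : ℝ) 1) : x + t • y ∈ ball x₀ (2 * ρ) := by
  rw [mem_ball_iff_norm] at hx hy ⊢
  have hyρ : ‖y‖ ≤ ρ := by linarith [norm_sub_norm_le y p]
  have hty : ‖t • y‖ ≤ ρ := by
    rw [norm_smul, Real.norm_of_nonneg ht.1]
    exact (mul_le_of_le_one_left (norm_nonneg y) ht.2).trans hyρ
  calc ‖x + t • y - x₀‖ = ‖(x - x₀) + t • y‖ := by rw [sub_add_eq_add_sub]
    _ ≤ ‖x - x₀‖ + ‖t • y‖ := norm_add_le _ _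
    _ < 2 * ρ := by linarith

lemma hasConeAt_of_isOpen {E : Type*} [NormedAddCommGroup E] [NormedSpace ℝ E] [Nontrivial E]
    {O : Set E} (hO : IsOpen O) {x₀ : E} (hx₀ : x₀ ∈ O) : HasConeAt O x₀ := by
  obtain ⟨r, hr, hrO⟩ := Metric.isOpen_iff.1 hO x₀ hx₀
  obtain ⟨p, hp⟩ := exists_norm_eq E (show (0 : ℝ) ≤ r / 4 by positivity)
  refine ⟨r / 2, p, r / 8, by positivity, by positivity, by linarith, ?_⟩
  intro x hx y hy t ht
  refine hrO ?_
  rw [← mul_div_cancel₀ r two_ne_zero]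
  exact add_smul_mem_ball (by linarith) hx.2 hy ht

lemma abs_apply_sub_apply_le_dist (z w : Plane) (i : Fin 2) : |z i - w i| ≤ dist z w := by
  simpa [dist_eq_norm] using PiLp.norm_apply_le (z - w) i

lemma mul_abs_apply_zero_le_apply_one {K h b : ℝ} (hK : 0 ≤ K) (hKb : (K + 1) * b ≤ h) {y : Plane}
    (hy : y ∈ ball (EuclideanSpace.single 1 h) b) : K * |y 0| ≤ y 1 := by
  have hdist (i : Fin 2) : |y i - EuclideanSpace.single (1 : Fin 2) h i| < b :=
    (abs_apply_sub_apply_le_dist _ _ i).trans_lt hy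
  have h0 : |y 0| < b := by simpa using hdist 0
  have h1 : |y 1 - h| < b := by simpa using hdist 1
  calc K * |y 0| ≤ K * b := by gcongr
    _ ≤ h - b := by linarith
    _ ≤ y 1 := by linarith [(abs_lt.1 h1).1]

lemma lt_apply_add_of_lipschitzOnWith {γ : ℝ → ℝ} {K : ℝ≥0} {s : Set ℝ} (hγ : LipschitzOnWith K γ s)
    {a a' c c' : ℝ} (ha : a ∈ s) (ha' : a + a' ∈ s) (hslope : K * |a'| ≤ c') (hlt : γ a < c) :
    γ (a + a') < c + c' := by
  have hlip := hγ.dist_le_mul _ ha' _ ha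
  rw [Real.dist_eq, Real.dist_eq, add_sub_cancel_left] at hlip
  linarith [le_abs_self (γ (a + a') - γ a)]

lemma hasConeAt_of_epigraph {O : Set Plane} {x₀ : Plane} (e : Plane ≃ₗᵢ[ℝ] Plane) {γ : ℝ → ℝ}
    {r : ℝ} (hγ : ContDiffAt ℝ 1 γ (e x₀ 0)) (hr : 0 < r)
    (hgraph : ∀ x ∈ ball x₀ r, x ∈ O ↔ γ (e x 0) < e x 1) : HasConeAt O x₀ := by
  obtain ⟨K, s, hs, hK⟩ := hγ.exists_lipschitzOnWith
  obtain ⟨η, hη, hηs⟩ := Metric.mem_nhds_iff.1 hs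
  set ρ := min r η / 2 with hρ
  have hρ0 : 0 < ρ := by positivity
  have hρr : 2 * ρ ≤ r := by linarith [min_le_left r η]
  have hnear {z : Plane} (hz : z ∈ ball x₀ (2 * ρ)) : e z 0 ∈ s := by
    refine hηs ((abs_apply_sub_apply_le_dist (e z) (e x₀) 0).trans_lt ?_)
    rw [e.dist_map]
    exact (Metric.mem_ball.1 hz).trans_le (by linarith [min_le_right r η])
  set q : Plane := EuclideanSpace.single 1 (ρ / 2) with hq
  set b := ρ / 2 / (K + 1 + 1)
  have hKb : (K + 1) * b < ρ / 2 := by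
    have hb0 : 0 < b := by positivity
    have hcancel : b * (K + 1 + 1) = ρ / 2 := div_mul_cancel₀ _ (by positivity)
    linarith
  have hp : ‖e.symm q‖ = ρ / 2 := by
    rw [LinearIsometryEquiv.norm_map, hq, PiLp.norm_single, Real.norm_of_nonneg (by positivity)]
  have hbρ : b < ρ / 2 :=
    (le_mul_of_one_le_left (by positivity) (by simp)).trans_lt hKb
  refine ⟨ρ, e.symm q, b, hρ0, by positivity, by rwa [hp], ?_⟩
  rintro x ⟨hxO, hx⟩ y hy t ht
  have hx2 : x ∈ ball x₀ (2 * ρ) := Metric.ball_subset_ball (by linarith) hx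
  have hxy : x + t • y ∈ ball x₀ (2 * ρ) := add_smul_mem_ball (by linarith) hx hy ht
  have hey : e y ∈ ball q b := by
    rwa [Metric.mem_ball, ← e.apply_symm_apply q, e.dist_map]
  have hslope : K * |t * e y 0| ≤ t * e y 1 := by
    rw [abs_mul, abs_of_nonneg ht.1, mul_left_comm]
    exact mul_le_mul_of_nonneg_left (mul_abs_apply_zero_le_apply_one K.2 hKb.le hey) ht.1
  have hxyγ := lt_apply_add_of_lipschitzOnWith hK (hnear hx2) (by simpa using hnear hxy) hslope
    ((hgraph x (Metric.ball_subset_ball hρr hx2)).1 hxO)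
  exact (hgraph _ (Metric.ball_subset_ball hρr hxy)).2 (by simpa using hxyγ)

lemma IsSmoothBoundedOpen.hasConeAt {O : Set Plane} (hO : IsSmoothBoundedOpen O) {x₀ : Plane}
    (hx₀ : x₀ ∈ closure O) : HasConeAt O x₀ := by
  by_cases hx : x₀ ∈ O
  · exact hasConeAt_of_isOpen hO.isOpen hx
  · have hfrontier : x₀ ∈ frontier O := hO.isOpen.frontier_eq ▸ ⟨hx₀, hx⟩
    obtain ⟨e, γ, r, hγ, hr, hgraph⟩ := hO.smooth_boundary x₀ hfrontier
    exact hasConeAt_of_epigraph e (hγ.of_le (by exact_mod_cast le_top)).contDiffAt hr hgraph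

end ConeProperty

section WeakGradient

variable {O U : Set Plane} {v : Plane → ℝ} {g : Plane → Plane}

lemma fderiv_apply_eq_sum_partialDeriv (φ : Plane → ℝ) (x y : Plane) :
    fderiv ℝ φ x y = ∑ i, y i * partialDeriv i φ x := by
  conv_lhs => rw [← (EuclideanSpace.basisFun (Fin 2) ℝ).sum_repr y, map_sum]
  simp [partialDeriv]

lemma IsWeakGradient.isWeakDirDeriv (h : IsWeakGradient O v g) (hO : MeasurableSet O)
    (hv : IntegrableOn v O) (hg : IntegrableOn g O) (y : Plane) :
    IsWeakDirDeriv volume O y (O.indicator v) (O.indicator fun z => inner ℝ (g z) y) := by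
  intro φ hφ hφc hφO
  have hint {f ψ : Plane → ℝ} (hf : Integrable f (volume.restrict O)) (hψ : Continuous ψ)
      (hψc : HasCompactSupport ψ) : Integrable (fun x => f x * ψ x) (volume.restrict O) :=
    hf.locallyIntegrable.integrable_smul_right_of_hasCompactSupport hψ hψc
  have hvφ (i : Fin 2) : IntegrableOn (fun x => y i * (v x * partialDeriv i φ x)) O :=
    (hint hv ((hφ.continuous_fderiv (by simp)).clm_apply continuous_const)
      (hφc.fderiv_apply (𝕜 := ℝ) _)).const_mul _
  have hgφ (i : Fin 2) : IntegrableOn (fun x => y i * (g x i * φ x)) O :=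
    (hint ((EuclideanSpace.proj (𝕜 := ℝ) i).integrable_comp hg) hφ.continuous hφc).const_mul _
  have hinner (x : Plane) : inner ℝ (g x) y = ∑ i, y i * g x i := by
    simp [PiLp.inner_apply]
  calc ∫ x, fderiv ℝ φ x y * O.indicator v x
      = ∫ x in O, fderiv ℝ φ x y * v x := by
        simp only [← integral_indicator hO, Set.indicator_mul_right]
    _ = ∫ x in O, ∑ i, y i * (v x * partialDeriv i φ x) := by
        simp only [fderiv_apply_eq_sum_partialDeriv, Finset.sum_mul, mul_assoc, mul_comm (v _)]
    _ = ∑ i, y i * -∫ x in O, g x i * φ x := by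
        rw [integral_finsetSum _ fun i _ => hvφ i]
        simp only [integral_const_mul, h φ ⟨hφ, hφc, hφO⟩]
    _ = -∫ x in O, ∑ i, y i * (g x i * φ x) := by
        rw [integral_finsetSum _ fun i _ => hgφ i]
        simp only [integral_const_mul, mul_neg, Finset.sum_neg_distrib]
    _ = -∫ x in O, φ x * inner ℝ (g x) y := by
        simp only [hinner, mul_comm (φ _), Finset.sum_mul, mul_assoc]
    _ = -∫ x, φ x * O.indicator (fun z => inner ℝ (g z) y) x := by
        simp only [← integral_indicator hO, Set.indicator_mul_right]

lemma enorm_indicator_inner_le (O : Set Plane) (g : Plane → Plane) (x y : Plane) :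
    ‖O.indicator (fun z => inner ℝ (g z) y) x‖ₑ ≤ ‖y‖ₑ * ‖O.indicator g x‖ₑ := by
  by_cases hx : x ∈ O
  · rw [Set.indicator_of_mem hx, Set.indicator_of_mem hx, ← ofReal_norm, ← ofReal_norm,
      ← ofReal_norm, ← ENNReal.ofReal_mul (norm_nonneg y), mul_comm]
    exact ENNReal.ofReal_le_ofReal (norm_inner_le_norm _ _)
  · simp [hx]

lemma IsWeakGradient.ae_enorm_indicator_le (h : IsWeakGradient O v g) (hO : MeasurableSet O)
    (hv : IntegrableOn v O) (hg : IntegrableOn g O) (hU : IsOpen U) {y : Plane}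
    (hy : ∀ x ∈ U, ∀ t ∈ Icc (0 : ℝ) 1, x + t • y ∈ O) :
    ∀ᵐ x, x ∈ U → ‖O.indicator v x‖ₑ ≤ ‖O.indicator v (x + y)‖ₑ
      + ‖y‖ₑ * ∫⁻ t in Ioc (0 : ℝ) 1, ‖O.indicator g (x + t • y)‖ₑ := by
  have hG : Integrable (O.indicator fun z => inner ℝ (g z) y) :=
    (integrable_indicator_iff hO).2 (hg.inner_const y)
  filter_upwards [(h.isWeakDirDeriv hO hv hg y).ae_add_sub_eq
    ((integrable_indicator_iff hO).2 hv) hG hU hy] with x hx hxU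
  rw [← sub_sub_cancel (O.indicator v (x + y)) (O.indicator v x), hx hxU]
  refine enorm_sub_le.trans ?_
  gcongr
  refine (enorm_integral_le_lintegral_enorm _).trans ?_
  rw [← lintegral_const_mul' _ _ enorm_ne_top]
  exact lintegral_mono fun t => enorm_indicator_inner_le O g _ y

end WeakGradient

section Pairing

variable {O s t : Set Plane}

/-- The estimate of the `L²` pairing with `H¹(O)` restricted to `O ∩ s`, with a cut-off scale `δ`:
a bound by `‖ξ‖_{L¹}`, at the price of `log^{1/2} δ⁻¹`, up to `δ ‖ξ‖_{L²}`. It is an intermediate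
notion for passing from a neighbourhood of each point of `closure O` to all of `O`. -/
def HasPairingBound (O s : Set Plane) : Prop :=
  ∃ C : ℝ≥0, ∀ ξ : L2 O, ∀ q ∈ H1 O, ∀ δ : ℝ, 0 < δ → δ ≤ 1 →
    ∫⁻ x in O ∩ s, ‖ξ x‖ₑ * ‖q.fst x‖ₑ ≤
      C * ((∫⁻ x in O, ‖ξ x‖ₑ) *
          (‖q.fst‖ₑ + ENNReal.ofReal (Real.log δ⁻¹) ^ (1 / 2 : ℝ) * ‖q.snd‖ₑ)
        + ENNReal.ofReal δ * (‖ξ‖ₑ * ‖q.snd‖ₑ))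

lemma HasPairingBound.mono (hst : s ⊆ t) (h : HasPairingBound O t) : HasPairingBound O s := by
  obtain ⟨C, h⟩ := h
  exact ⟨C, fun ξ q hq δ hδ hδ1 =>
    (lintegral_mono_set (Set.inter_subset_inter_right O hst)).trans (h ξ q hq δ hδ hδ1)⟩

lemma HasPairingBound.union (hs : HasPairingBound O s) (ht : HasPairingBound O t) :
    HasPairingBound O (s ∪ t) := by
  obtain ⟨C, hC⟩ := hs
  obtain ⟨D, hD⟩ := ht
  refine ⟨C + D, fun ξ q hq δ hδ hδ1 => ?_⟩
  rw [Set.inter_union_distrib_left, ENNReal.coe_add, add_mul]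
  exact (lintegral_union_le _ _ _).trans
    (add_le_add (hC ξ q hq δ hδ hδ1) (hD ξ q hq δ hδ hδ1))

lemma eLpNorm'_enorm_indicator {α E : Type*} [MeasurableSpace α] {μ : Measure α}
    [NormedAddCommGroup E] {s : Set α} (hs : MeasurableSet s) (f : Lp E 2 (μ.restrict s)) :
    eLpNorm' (fun x => ‖s.indicator f x‖ₑ) 2 μ = ‖f‖ₑ := by
  rw [eLpNorm'_enorm, Lp.enorm_def, ← eLpNorm_indicator_eq_eLpNorm_restrict hs,
    eLpNorm_eq_eLpNorm' two_ne_zero ENNReal.ofNat_ne_top, ENNReal.toReal_ofNat]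

lemma HasConeAt.exists_hasPairingBound (hO : IsOpen O) (hbdd : Bornology.IsBounded O) {x₀ : Plane}
    (hcone : HasConeAt O x₀) : ∃ s ∈ nhds x₀, HasPairingBound O s := by
  have hOm : MeasurableSet O := hO.measurableSet
  have : IsFiniteMeasure (volume.restrict O) := ⟨by simpa using hbdd.measure_lt_top⟩
  obtain ⟨ρ, p, b, hρ, hb, hbp, hcone⟩ := hcone
  set U := O ∩ ball x₀ ρ
  have hU : IsOpen U := hO.inter Metric.isOpen_ball
  have hdim : ((finrank ℝ Plane : ℕ) : ℝ) = 2 := by simp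
  obtain ⟨C, hC⟩ := exists_lintegral_mul_le_of_ae_le_along_segments (volume : Measure Plane)
    (hdim ▸ Real.HolderConjugate.two_two) hb hbp
  refine ⟨ball x₀ ρ, Metric.ball_mem_nhds x₀ hρ, C, fun ξ q hq δ hδ hδ1 => ?_⟩
  have hmeas {E : Type} [NormedAddCommGroup E] (f : Lp E 2 (volume.restrict O)) :
      Measurable fun x => ‖O.indicator f x‖ₑ :=
    ((Lp.stronglyMeasurable f).indicator hOm).enorm
  have hint {E : Type} [NormedAddCommGroup E] (f : Lp E 2 (volume.restrict O)) :
      IntegrableOn f O := (Lp.memLp f).integrable one_le_two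
  have hbound := hC U _ _ _ δ hU.measurableSet (hmeas ξ) (hmeas q.fst) (hmeas q.snd) hδ hδ1
    fun y hy => IsWeakGradient.ae_enorm_indicator_le hq hOm (hint q.fst) (hint q.snd) hU
      fun x hx => hcone x hx y hy
  have hξ : ∫⁻ x, ‖O.indicator ξ x‖ₑ = ∫⁻ x in O, ‖ξ x‖ₑ := by
    simp only [enorm_indicator_eq_indicator_enorm, lintegral_indicator hOm]
  have hpair : ∫⁻ x in U, ‖O.indicator ξ x‖ₑ * ‖O.indicator q.fst x‖ₑ =
      ∫⁻ x in U, ‖ξ x‖ₑ * ‖q.fst x‖ₑ :=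
    setLIntegral_congr_fun hU.measurableSet fun x hx => by simp only [Set.indicator_of_mem hx.1]
  simpa only [hξ, hpair, hdim, eLpNorm'_enorm_indicator hOm, one_div] using hbound

lemma hasPairingBound_of_hasConeAt (hO : IsOpen O) (hbdd : Bornology.IsBounded O)
    (hcone : ∀ x₀ ∈ closure O, HasConeAt O x₀) : HasPairingBound O (closure O) := by
  refine hbdd.isCompact_closure.induction_on ⟨0, by simp⟩ (fun _ _ => .mono) (fun _ _ => .union) ?_
  intro x₀ hx₀
  obtain ⟨s, hs, hbound⟩ := (hcone x₀ hx₀).exists_hasPairingBound hO hbdd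
  exact ⟨s, mem_nhdsWithin_of_mem_nhds hs, hbound⟩

lemma enorm_toH1Dual_apply_le (ξ : L2 O) (q : H1 O) :
    ‖L2.toH1Dual ξ q‖ₑ ≤ ∫⁻ x in O, ‖ξ x‖ₑ * ‖q.1.fst x‖ₑ := by
  have hinner : L2.toH1Dual ξ q = ∫ x in O, inner ℝ (ξ x) (q.1.fst x) := L2.inner_def ξ q.1.fst
  rw [hinner]
  refine (enorm_integral_le_lintegral_enorm _).trans_eq ?_
  simp only [Real.inner_apply, enorm_mul]

lemma HasPairingBound.exists_norm_toH1Dual_le (hfin : volume O ≠ ⊤)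
    (h : HasPairingBound O (closure O)) :
    ∃ C : ℝ≥0, ∀ ξ : L2 O, ∀ δ : ℝ, 0 < δ → δ ≤ 1 →
      ‖L2.toH1Dual ξ‖ ≤
        C * ((∫ x in O, |ξ x|) * (1 + Real.sqrt (Real.log δ⁻¹)) + δ * ‖ξ‖) := by
  have : IsFiniteMeasure (volume.restrict O) := ⟨by simpa using hfin.lt_top⟩
  obtain ⟨C, hC⟩ := h
  refine ⟨C, fun ξ δ hδ hδ1 => ?_⟩
  have hlog : 0 ≤ Real.log δ⁻¹ := Real.log_nonneg ((one_le_inv₀ hδ).2 hδ1)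
  have hL1 : 0 ≤ ∫ x in O, |ξ x| := integral_nonneg fun _ => abs_nonneg _
  refine ContinuousLinearMap.opNorm_le_bound _ (by positivity) fun q => ?_
  have hsq : ‖q‖ ^ 2 = ‖q.1.fst‖ ^ 2 + ‖q.1.snd‖ ^ 2 := WithLp.prod_norm_sq_eq_of_L2 q.1
  have hv : ‖q.1.fst‖ₑ ≤ ‖q‖ₑ := enorm_le_iff_norm_le.2 <|
    le_of_sq_le_sq (by nlinarith [sq_nonneg ‖q.1.snd‖]) (norm_nonneg q)
  have hg : ‖q.1.snd‖ₑ ≤ ‖q‖ₑ := enorm_le_iff_norm_le.2 <|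
    le_of_sq_le_sq (by nlinarith [sq_nonneg ‖q.1.fst‖]) (norm_nonneg q)
  have hint : ∫⁻ x in O, ‖ξ x‖ₑ = ENNReal.ofReal (∫ x in O, |ξ x|) :=
    (ofReal_integral_norm_eq_lintegral_enorm ((Lp.memLp ξ).integrable one_le_two)).symm
  have hsqrt : ENNReal.ofReal (Real.log δ⁻¹) ^ (1 / 2 : ℝ) =
      ENNReal.ofReal (Real.sqrt (Real.log δ⁻¹)) := by
    rw [ENNReal.ofReal_rpow_of_nonneg hlog (by norm_num), Real.sqrt_eq_rpow]
  rw [← ENNReal.ofReal_le_ofReal_iff (by positivity), ofReal_norm]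
  calc ‖L2.toH1Dual ξ q‖ₑ ≤ ∫⁻ x in O ∩ closure O, ‖ξ x‖ₑ * ‖q.1.fst x‖ₑ := by
        rw [Set.inter_eq_left.2 subset_closure]
        exact enorm_toH1Dual_apply_le ξ q
    _ ≤ _ := hC ξ q.1 q.2 δ hδ hδ1
    _ ≤ C * (ENNReal.ofReal (∫ x in O, |ξ x|) *
          (‖q‖ₑ + ENNReal.ofReal (Real.sqrt (Real.log δ⁻¹)) * ‖q‖ₑ)
          + ENNReal.ofReal δ * (‖ξ‖ₑ * ‖q‖ₑ)) := by
        rw [hint, hsqrt]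
        gcongr
    _ = C * (ENNReal.ofReal (∫ x in O, |ξ x|) * (1 + ENNReal.ofReal (Real.sqrt (Real.log δ⁻¹)))
          + ENNReal.ofReal δ * ‖ξ‖ₑ) * ‖q‖ₑ := by ring
    _ = _ := by
        rw [← ofReal_norm, ← ofReal_norm, ENNReal.ofReal_mul (by positivity),
          ENNReal.ofReal_mul C.coe_nonneg, ENNReal.ofReal_coe_nnreal,
          ENNReal.ofReal_add (by positivity) (by positivity), ENNReal.ofReal_mul hL1,
          ENNReal.ofReal_add one_pos.le (Real.sqrt_nonneg _), ENNReal.ofReal_one,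
          ENNReal.ofReal_mul hδ.le]

end Pairing

theorem lemmaA1_general {O : Set Plane} (hO : IsOpen O) (hbdd : Bornology.IsBounded O)
    (hcone : ∀ x₀ ∈ closure O, HasConeAt O x₀) :
    ∃ c : ℝ, 0 < c ∧ ∀ ξ : L2 O,
      ‖L2.toH1Dual ξ‖ ≤
        c * (1 + (∫ x in O, |ξ x|) * Real.sqrt (Real.log (Real.exp 1 + ‖ξ‖))) := by
  obtain ⟨C, hC⟩ := (hasPairingBound_of_hasConeAt hO hbdd hcone).exists_norm_toH1Dual_le
    hbdd.measure_lt_top.ne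
  refine ⟨2 * C + 1, by positivity, fun ξ => ?_⟩
  set I := ∫ x in O, |ξ x|
  set R := Real.exp 1 + ‖ξ‖
  have : 0 ≤ I := integral_nonneg fun _ => abs_nonneg _
  have heR : Real.exp 1 ≤ R := le_add_of_nonneg_right (norm_nonneg ξ)
  have hR : 0 < R := (Real.exp_pos 1).trans_le heR
  have hR1 : 1 ≤ R := (Real.one_le_exp zero_le_one).trans heR
  have hsqrt : 1 ≤ Real.sqrt (Real.log R) := Real.one_le_sqrt.2 ((Real.le_log_iff_exp_le hR).2 heR)
  have hξ : R⁻¹ * ‖ξ‖ ≤ 1 :=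
    (inv_mul_le_one₀ hR).2 (le_add_of_nonneg_left (Real.exp_pos 1).le)
  calc ‖L2.toH1Dual ξ‖ ≤ C * (I * (1 + Real.sqrt (Real.log R)) + R⁻¹ * ‖ξ‖) := by
        simpa only [inv_inv] using hC ξ R⁻¹ (inv_pos.2 hR) (inv_le_one_of_one_le₀ hR1)
    _ ≤ C * (I * (2 * Real.sqrt (Real.log R)) + 2) := by
        gcongr <;> linarith
    _ ≤ (2 * C + 1) * (1 + I * Real.sqrt (Real.log R)) := by
        have : 0 ≤ I * Real.sqrt (Real.log R) := by positivity
        linarith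

theorem lemmaA1 (O : Set Plane) (hO : IsSmoothBoundedOpen O) :
    ∃ c : ℝ, 0 < c ∧ ∀ ξ : L2 O,
      ‖L2.toH1Dual ξ‖ ≤
        c * (1 + (∫ x in O, |ξ x|) * Real.sqrt (Real.log (Real.exp 1 + ‖ξ‖))) :=
  lemmaA1_general hO.isOpen hO.isBounded fun _ => hO.hasConeAt
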